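/- Let $K$ be an algebraically closed field and $s\ge 1$ an integer. Let $\Gamma_s$ be the quiver with vertex set $\mathbb Z/s$ and, for each vertex $i$, two arrows $a_i,b_i\colon i\to i+1$. In the path algebra $K\Gamma_s$ (paths are composed from left to right, $e_i$ is the trivial path at $i$) put $x=\sum_i a_i$, $y=\sum_i b_i$, and let $$\Lambda_s=K\Gamma_s/\langle x^2,\;xy+yx,\;y^2\rangle .$$ All bimodules are $\Lambda_s$-$\Lambda_s$-bimodules on which $K$ acts centrally, that is, modules over the enveloping algebra $\Lambda_s^e$, and $\otimes=\otimes_K$. For $n\ge 0$ let $$Q^n=\bigoplus_{i\in\mathbb Z/s}\ \bigoplus_{j=0}^{n}\Lambda_s e_i\otimes e_{i+n}\Lambda_s ,$$ and let $b^n_{i,j}$ be the element $e_i\otimes e_{i+n}$ of the summand with index $(i,j)$; subscripts $i$ are taken modulo $s$. Let $\partial^0\colon Q^0\to\Lambda_s$ be the multiplication map, $u\otimes w\mapsto uw$ on every summand, and for $n\ge 1$ let $\partial^n\colon Q^n\to Q^{n-1}$ be the bimodule homomorphism determined by $$b^n_{i,0}\mapsto b^{n-1}_{i,0}\,y+(-1)^n\,y\,b^{n-1}_{i+1,0},\qquad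 b^n_{i,n}\mapsto b^{n-1}_{i,n-1}\,x+(-1)^n\,x\,b^{n-1}_{i+1,n-1},$$ $$b^n_{i,j}\mapsto \bigl(b^{n-1}_{i,j-1}\,x+b^{n-1}_{i,j}\,y\bigr)+(-1)^n\bigl(y\,b^{n-1}_{i+1,j}+x\,b^{n-1}_{i+1,j-1}\bigr)\qquad(1\le j\le n-1).$$ Then $(Q^\bullet,\partial^\bullet)$ is a minimal projective resolution of $\Lambda_s$ as a bimodule over itself. That is, the sequence $\cdots\to Q^2\xrightarrow{\partial^2}Q^1\xrightarrow{\partial^1}Q^0\xrightarrow{\partial^0}\Lambda_s\to 0$ is exact, $\partial^0$ is a projective cover of $\Lambda_s$, and for every $n\ge 1$ the map $\partial^n\colon Q^n\to\operatorname{Im}\partial^n$ is a projective cover. Here a projective cover of $M$ is an epimorphism $f\colon P\to M$ with $P$ projective such that $\operatorname{Ker}f$ is superfluous in $P$ (if $X$ is a submodule of $P$ with $\operatorname{Ker} f+X=P$, then $X=P$). -/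

import Mathlib

open scoped TensorProduct DirectSum

noncomputable section

/-! ### Path algebras -/

/-- The path algebra `K V` of a quiver with vertex set `V`: as a vector space it has the paths
as a basis. -/
def PathAlgebra (K V : Type*) [Field K] [Quiver V] : Type _ :=
  (Σ i j : V, Quiver.Path i j) →₀ K

namespace PathAlgebra

variable (K : Type*) {V : Type*} [Field K] [Quiver V]

instance : AddCommGroup (PathAlgebra K V) :=
  inferInstanceAs (AddCommGroup ((Σ i j : V, Quiver.Path i j) →₀ K))

instance : Module K (PathAlgebra K V) :=
  inferInstanceAs (Module K ((Σ i j : V, Quiver.Path i j) →₀ K))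

/-- The basis element of the path algebra given by a path. -/
def path {i j : V} (p : Quiver.Path i j) : PathAlgebra K V :=
  Finsupp.single (⟨i, j, p⟩ : Σ i j : V, Quiver.Path i j) (1 : K)

/-- The product of two paths: first `p`, then `q` if the terminus of `p` is the origin of `q`,
and `0` otherwise. -/
def pathMul [DecidableEq V] (p q : Σ i j : V, Quiver.Path i j) : PathAlgebra K V :=
  if h : q.1 = p.2.1 then path K (p.2.2.comp (q.2.2.cast h rfl)) else 0

/-- The linear map with prescribed values on the paths. -/
def lift {M : Type*} [AddCommGroup M] [Module K M] (f : (Σ i j : V, Quiver.Path i j) → M) :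
    PathAlgebra K V →ₗ[K] M :=
  Finsupp.linearCombination K f

theorem lift_path {M : Type*} [AddCommGroup M] [Module K M]
    (f : (Σ i j : V, Quiver.Path i j) → M) {i j : V} (p : Quiver.Path i j) :
    lift K f (path K p) = f ⟨i, j, p⟩ :=
  (Finsupp.linearCombination_single K (1 : K) _).trans (one_smul K _)

/-- The bilinear extension of the product of paths. -/
def mulHom [DecidableEq V] : PathAlgebra K V →ₗ[K] PathAlgebra K V →ₗ[K] PathAlgebra K V :=
  lift K fun p => lift K fun q => pathMul K p q

instance [DecidableEq V] : Mul (PathAlgebra K V) := ⟨fun f g => mulHom K f g⟩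

/-- The trivial path at a vertex. -/
def e (i : V) : PathAlgebra K V := path K (Quiver.Path.nil : Quiver.Path i i)

/-- An arrow, as an element of the path algebra. -/
def arrow {i j : V} (a : i ⟶ j) : PathAlgebra K V := path K a.toPath

instance [Fintype V] : One (PathAlgebra K V) := ⟨∑ i, e K i⟩

theorem mul_def [DecidableEq V] (f g : PathAlgebra K V) : f * g = mulHom K f g := rfl

theorem one_def [Fintype V] : (1 : PathAlgebra K V) = ∑ i, e K i := rfl

variable {K} in
theorem induction {P : PathAlgebra K V → Prop} (f : PathAlgebra K V) (h0 : P 0)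
    (hadd : ∀ f g, P f → P g → P (f + g))
    (hpath : ∀ (c : K) (i j : V) (p : Quiver.Path i j), P (c • path K p)) : P f := by
  refine Finsupp.induction_linear (motive := P) f h0 hadd ?_
  rintro ⟨i, j, p⟩ c
  have h : (Finsupp.single (⟨i, j, p⟩ : Σ i j : V, Quiver.Path i j) c) = c • path K p :=
    (Finsupp.smul_single_one _ c).symm
  exact h ▸ hpath c i j p

theorem mulHom_path [DecidableEq V] {i j k l : V} (p : Quiver.Path i j) (q : Quiver.Path k l) :
    mulHom K (path K p) (path K q) = pathMul K ⟨i, j, p⟩ ⟨k, l, q⟩ := by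
  rw [mulHom, lift_path, lift_path]

theorem path_mul_path [DecidableEq V] {i j l : V} (p : Quiver.Path i j) (q : Quiver.Path j l) :
    path K p * path K q = path K (p.comp q) := by
  rw [mul_def, mulHom_path]
  simp [pathMul]

theorem path_mul_path_of_ne [DecidableEq V] {i j k l : V} (p : Quiver.Path i j)
    (q : Quiver.Path k l) (h : k ≠ j) : path K p * path K q = 0 := by
  rw [mul_def, mulHom_path]
  simp [pathMul, h]

theorem pa_mul_add [DecidableEq V] (f g h : PathAlgebra K V) : f * (g + h) = f * g + f * h := by
  simp [mul_def]

theorem pa_add_mul [DecidableEq V] (f g h : PathAlgebra K V) : (f + g) * h = f * h + g * h := by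
  simp [mul_def]

theorem pa_mul_smul [DecidableEq V] (c : K) (f g : PathAlgebra K V) :
    f * (c • g) = c • (f * g) := by
  simp [mul_def]

theorem pa_smul_mul [DecidableEq V] (c : K) (f g : PathAlgebra K V) :
    (c • f) * g = c • (f * g) := by
  simp [mul_def]

theorem pa_zero_mul [DecidableEq V] (f : PathAlgebra K V) : 0 * f = 0 := by
  simp [mul_def]

theorem pa_mul_zero [DecidableEq V] (f : PathAlgebra K V) : f * 0 = 0 := by
  simp [mul_def]

theorem path_mul_assoc [DecidableEq V] {i j k l m n : V} (p : Quiver.Path i j)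
    (q : Quiver.Path k l) (r : Quiver.Path m n) :
    path K p * path K q * path K r = path K p * (path K q * path K r) := by
  by_cases h : k = j
  · subst h
    by_cases h' : m = l
    · subst h'
      simp only [path_mul_path, Quiver.Path.comp_assoc]
    · rw [path_mul_path_of_ne K q r h', path_mul_path, path_mul_path_of_ne K _ r h', pa_mul_zero]
  · rw [path_mul_path_of_ne K p q h, pa_zero_mul]
    by_cases h' : m = l
    · subst h'
      rw [path_mul_path, path_mul_path_of_ne K p _ h]
    · rw [path_mul_path_of_ne K q r h', pa_mul_zero]

theorem pa_mul_assoc [DecidableEq V] (f g h : PathAlgebra K V) : f * g * h = f * (g * h) := by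
  induction f using induction with
  | h0 => simp only [pa_zero_mul]
  | hadd f f' hf hf' => simp only [pa_add_mul, hf, hf']
  | hpath c i j p =>
    induction g using induction with
    | h0 => simp only [pa_zero_mul, pa_mul_zero]
    | hadd g g' hg hg' => simp only [pa_add_mul, pa_mul_add, hg, hg']
    | hpath c' k l q =>
      induction h using induction with
      | h0 => simp only [pa_mul_zero]
      | hadd h h' hh hh' => simp only [pa_mul_add, hh, hh']
      | hpath c'' m n r => simp only [pa_smul_mul, pa_mul_smul, path_mul_assoc]

theorem pa_sum_mul [DecidableEq V] {ι : Type*} (t : Finset ι) (u : ι → PathAlgebra K V)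
    (f : PathAlgebra K V) : (∑ i ∈ t, u i) * f = ∑ i ∈ t, u i * f := by
  simp [mul_def]

theorem pa_mul_sum [DecidableEq V] {ι : Type*} (t : Finset ι) (u : ι → PathAlgebra K V)
    (f : PathAlgebra K V) : f * (∑ i ∈ t, u i) = ∑ i ∈ t, f * u i := by
  simp [mul_def]

theorem pa_one_mul [DecidableEq V] [Fintype V] (f : PathAlgebra K V) : 1 * f = f := by
  induction f using induction with
  | h0 => exact pa_mul_zero K _
  | hadd f g hf hg => rw [pa_mul_add, hf, hg]
  | hpath c i j p =>
    rw [pa_mul_smul, one_def, pa_sum_mul, Finset.sum_eq_single i]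
    · rw [e, path_mul_path, Quiver.Path.nil_comp]
    · intro k _ hk
      exact path_mul_path_of_ne K _ _ hk.symm
    · simp

theorem pa_mul_one [DecidableEq V] [Fintype V] (f : PathAlgebra K V) : f * 1 = f := by
  induction f using induction with
  | h0 => exact pa_zero_mul K _
  | hadd f g hf hg => rw [pa_add_mul, hf, hg]
  | hpath c i j p =>
    rw [pa_smul_mul, one_def, pa_mul_sum, Finset.sum_eq_single j]
    · rw [e, path_mul_path, Quiver.Path.comp_nil]
    · intro k _ hk
      exact path_mul_path_of_ne K _ _ hk
    · simp

instance [DecidableEq V] [Fintype V] : Ring (PathAlgebra K V) :=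
  { (inferInstance : AddCommGroup (PathAlgebra K V)) with
    mul := (· * ·)
    one := 1
    left_distrib := pa_mul_add K
    right_distrib := pa_add_mul K
    zero_mul := pa_zero_mul K
    mul_zero := pa_mul_zero K
    mul_assoc := pa_mul_assoc K
    one_mul := pa_one_mul K
    mul_one := pa_mul_one K }

instance [DecidableEq V] [Fintype V] : Algebra K (PathAlgebra K V) :=
  Algebra.ofModule (pa_smul_mul K) (fun c f g => pa_mul_smul K c f g)

end PathAlgebra

/-! ### The circular quiver with double arrows and the algebra `Λ_s` -/

/-- The arrows of the circular quiver `Γ_s` with double arrows: for every vertex `i` two arrows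
`a_i` and `b_i` from `i` to `i + 1`, where vertices are taken modulo `s`. -/
inductive GammaArrow (s : ℕ) : ZMod s → ZMod s → Type
  | a (i : ZMod s) : GammaArrow s i (i + 1)
  | b (i : ZMod s) : GammaArrow s i (i + 1)

/-- The quiver `Γ_s`, with vertex set `ZMod s`. -/
instance gammaQuiver (s : ℕ) : Quiver (ZMod s) := ⟨GammaArrow s⟩

/-- The path algebra `K Γ_s`. -/
abbrev KGamma (K : Type*) [Field K] (s : ℕ) [NeZero s] : Type _ := PathAlgebra K (ZMod s)

namespace KGamma

variable (K : Type*) [Field K] (s : ℕ) [NeZero s]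

/-- `x = ∑ a_i` in `K Γ_s`. -/
def x : KGamma K s := ∑ i : ZMod s, PathAlgebra.arrow K (j := i + 1) (GammaArrow.a i)

/-- `y = ∑ b_i` in `K Γ_s`. -/
def y : KGamma K s := ∑ i : ZMod s, PathAlgebra.arrow K (j := i + 1) (GammaArrow.b i)

/-- The two-sided ideal `I = ⟨x², xy + yx, y²⟩`. -/
def I : TwoSidedIdeal (KGamma K s) :=
  TwoSidedIdeal.span {x K s ^ 2, x K s * y K s + y K s * x K s, y K s ^ 2}

theorem e_mul_arrow {i k l : ZMod s} (α : k ⟶ l) :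
    PathAlgebra.e K i * PathAlgebra.arrow K α = if i = k then PathAlgebra.arrow K α else 0 := by
  split_ifs with h
  · subst h
    rw [PathAlgebra.e, PathAlgebra.arrow, PathAlgebra.path_mul_path, Quiver.Path.nil_comp]
  · exact PathAlgebra.path_mul_path_of_ne K _ _ (Ne.symm h)

theorem arrow_mul_e {i k l : ZMod s} (α : k ⟶ l) :
    PathAlgebra.arrow K α * PathAlgebra.e K i = if l = i then PathAlgebra.arrow K α else 0 := by
  split_ifs with h
  · subst h
    rw [PathAlgebra.e, PathAlgebra.arrow, PathAlgebra.path_mul_path, Quiver.Path.comp_nil]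
  · exact PathAlgebra.path_mul_path_of_ne K _ _ (Ne.symm h)

theorem e_mul_x (i : ZMod s) :
    PathAlgebra.e K i * x K s = x K s * PathAlgebra.e K (i + 1) := by
  simp [x, Finset.mul_sum, Finset.sum_mul, e_mul_arrow, arrow_mul_e]

theorem e_mul_y (i : ZMod s) :
    PathAlgebra.e K i * y K s = y K s * PathAlgebra.e K (i + 1) := by
  simp [y, Finset.mul_sum, Finset.sum_mul, e_mul_arrow, arrow_mul_e]

end KGamma

/-- The bound quiver algebra `Λ_s = K Γ_s / I`. -/
def Lam (K : Type*) [Field K] (s : ℕ) [NeZero s] : Type _ := (KGamma.I K s).ringCon.Quotient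

namespace Lam

variable (K : Type*) [Field K] (s : ℕ) [NeZero s]

instance : Ring (Lam K s) := inferInstanceAs (Ring (KGamma.I K s).ringCon.Quotient)

instance : Algebra K (Lam K s) := inferInstanceAs (Algebra K (KGamma.I K s).ringCon.Quotient)

/-- The projection `K Γ_s → Λ_s`. -/
def mk : KGamma K s →+* Lam K s := (KGamma.I K s).ringCon.mk'

/-- The class of `x` in `Λ_s`. -/
def x : Lam K s := mk K s (KGamma.x K s)

/-- The class of `y` in `Λ_s`. -/
def y : Lam K s := mk K s (KGamma.y K s)

/-- The class of the trivial path `e_i` in `Λ_s`. -/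
def e (i : ZMod s) : Lam K s := mk K s (PathAlgebra.e K i)

theorem e_mul_e (i : ZMod s) : e K s i * e K s i = e K s i := by
  rw [e, ← map_mul, PathAlgebra.e, PathAlgebra.path_mul_path, Quiver.Path.comp_nil]

theorem e_mul_x (i : ZMod s) : e K s i * x K s = x K s * e K s (i + 1) := by
  rw [e, x, e, ← map_mul, KGamma.e_mul_x, map_mul]

theorem e_mul_y (i : ZMod s) : e K s i * y K s = y K s * e K s (i + 1) := by
  rw [e, y, e, ← map_mul, KGamma.e_mul_y, map_mul]

/-- The enveloping algebra `Λ_s ⊗_K Λ_sᵒᵖ`, over which the left modules are the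
`Λ_s`-`Λ_s`-bimodules on which `K` acts centrally: `a ⊗ op b` acts by `m ↦ a m b`. -/
def Env : Type _ := Lam K s ⊗[K] (Lam K s)ᵐᵒᵖ

instance : Ring (Env K s) := inferInstanceAs (Ring (Lam K s ⊗[K] (Lam K s)ᵐᵒᵖ))

instance : Algebra K (Env K s) := inferInstanceAs (Algebra K (Lam K s ⊗[K] (Lam K s)ᵐᵒᵖ))

/-- The element `a ⊗ op b` of the enveloping algebra. -/
def Env.tmul (a b : Lam K s) : Env K s := a ⊗ₜ[K] MulOpposite.op b

theorem Env.tmul_mul_tmul (a b a' b' : Lam K s) :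
    Env.tmul K s a b * Env.tmul K s a' b' = Env.tmul K s (a * a') (b' * b) :=
  Algebra.TensorProduct.tmul_mul_tmul a a' (MulOpposite.op b) (MulOpposite.op b')

theorem Env.induction {P : Env K s → Prop} (c : Env K s) (h0 : P 0)
    (hadd : ∀ c d, P c → P d → P (c + d)) (htmul : ∀ a b, P (Env.tmul K s a b)) : P c :=
  TensorProduct.induction_on (motive := P) c h0 (fun a b => htmul a b.unop) hadd

/-- `Λ_s` as a bimodule over itself: `(a ⊗ op b) • m = a m b`. -/
instance : Module (Env K s) (Lam K s) :=
  Module.compHom (Lam K s) (AlgHom.mulLeftRight K (Lam K s)).toRingHom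

theorem Env.tmul_smul (a b m : Lam K s) : Env.tmul K s a b • m = a * m * b :=
  AlgHom.mulLeftRight_apply K (Lam K s) a (MulOpposite.op b) m

/-- The left module `Λ_s e_i`. -/
def leftProj (i : ZMod s) : Submodule (Lam K s) (Lam K s) := Submodule.span _ {e K s i}

/-- The right module `e_k Λ_s`. -/
def rightProj (k : ZMod s) : Submodule (Lam K s)ᵐᵒᵖ (Lam K s) := Submodule.span _ {e K s k}

/-- The bimodule `Λ_s e_i ⊗_K e_k Λ_s`. -/
def BiProj (i k : ZMod s) : Type _ := leftProj K s i ⊗[K] rightProj K s k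

instance (i k : ZMod s) : AddCommGroup (BiProj K s i k) :=
  inferInstanceAs (AddCommGroup (leftProj K s i ⊗[K] rightProj K s k))

/-- The underlying `K`-module of the bimodule `Λ_s e_i ⊗_K e_k Λ_s`. -/
instance biProjBase (i k : ZMod s) : Module K (BiProj K s i k) :=
  inferInstanceAs (Module K (leftProj K s i ⊗[K] rightProj K s k))

/-- The bimodule structure, `(a ⊗ op b) • (u ⊗ w) = a u ⊗ w b`. -/
instance biProjModule (i k : ZMod s) : Module (Env K s) (BiProj K s i k) :=
  Module.compHom (leftProj K s i ⊗[K] rightProj K s k)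
    ((Module.endTensorEndAlgHom (R := K) (S := K) (A := K)
        (M := leftProj K s i) (N := rightProj K s k)).comp
      (Algebra.TensorProduct.map (Algebra.lsmul K K (leftProj K s i))
        (Algebra.lsmul K K (rightProj K s k)))).toRingHom

/-- The pure tensor `u ⊗ w`. -/
def BiProj.tmul {i k : ZMod s} (u : leftProj K s i) (w : rightProj K s k) : BiProj K s i k :=
  u ⊗ₜ[K] w

theorem BiProj.smul_tmul {i k : ZMod s} (a b : Lam K s) (u : leftProj K s i)
    (w : rightProj K s k) :
    Env.tmul K s a b • BiProj.tmul K s u w = BiProj.tmul K s (a • u) (MulOpposite.op b • w) := rfl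

theorem BiProj.induction {i k : ZMod s} {P : BiProj K s i k → Prop} (z : BiProj K s i k)
    (h0 : P 0) (hadd : ∀ z w, P z → P w → P (z + w))
    (htmul : ∀ u w, P (BiProj.tmul K s u w)) : P z :=
  TensorProduct.induction_on (motive := P) z h0 htmul hadd

/-- The inclusion `Λ_s e_i ⊗ e_k Λ_s → Λ_s ⊗ Λ_sᵒᵖ` as a `K`-linear map. -/
def inclK (i k : ZMod s) : BiProj K s i k →ₗ[K] Env K s :=
  (TensorProduct.map ((leftProj K s i).subtype.restrictScalars K)
    ((MulOpposite.opLinearEquiv K).toLinearMap ∘ₗ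
      (rightProj K s k).subtype.restrictScalars K) :
    leftProj K s i ⊗[K] rightProj K s k →ₗ[K] Lam K s ⊗[K] (Lam K s)ᵐᵒᵖ)

theorem inclK_tmul {i k : ZMod s} (u : leftProj K s i) (w : rightProj K s k) :
    inclK K s i k (BiProj.tmul K s u w) = Env.tmul K s u w := rfl

/-- The inclusion `Λ_s e_i ⊗ e_k Λ_s → Λ_s ⊗ Λ_sᵒᵖ` as a bimodule homomorphism. -/
def incl (i k : ZMod s) : BiProj K s i k →ₗ[Env K s] Env K s where
  toFun := inclK K s i k
  map_add' := map_add (inclK K s i k)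
  map_smul' c z := by
    rw [RingHom.id_apply]
    induction c using Env.induction with
    | h0 => rw [zero_smul, zero_smul, map_zero]
    | hadd c d hc hd => rw [add_smul, add_smul, map_add, hc, hd]
    | htmul a b =>
      induction z using BiProj.induction with
      | h0 => rw [smul_zero, map_zero, smul_zero]
      | hadd z w hz hw => rw [smul_add, map_add, map_add, smul_add, hz, hw]
      | htmul u w =>
        rw [BiProj.smul_tmul, inclK_tmul, inclK_tmul, smul_eq_mul, Env.tmul_mul_tmul]
        rfl

theorem incl_tmul {i k : ZMod s} (u : leftProj K s i) (w : rightProj K s k) :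
    incl K s i k (BiProj.tmul K s u w) = Env.tmul K s u w := rfl

/-- The generator `e_i ⊗ e_k` of `Λ_s e_i ⊗ e_k Λ_s`. -/
def BiProj.gen (i k : ZMod s) : BiProj K s i k :=
  BiProj.tmul K s ⟨e K s i, Submodule.mem_span_singleton_self _⟩
    ⟨e K s k, Submodule.mem_span_singleton_self _⟩

theorem BiProj.smul_gen (i k : ZMod s) :
    Env.tmul K s (e K s i) (e K s k) • BiProj.gen K s i k =
      BiProj.gen K s i k := by
  rw [BiProj.gen, BiProj.smul_tmul]
  congr 1 <;> exact Subtype.ext (e_mul_e K s _)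

/-- For an element `v` of a bimodule `M`, the bimodule homomorphism
`Λ_s e_i ⊗ e_k Λ_s → M`, `u ⊗ w ↦ u v w`. If `v ∈ e_i M e_k`, it is the bimodule homomorphism
that sends `e_i ⊗ e_k` to `v`. -/
def homOf {M : Type*} [AddCommGroup M] [Module (Env K s) M] (i k : ZMod s) (v : M) :
    BiProj K s i k →ₗ[Env K s] M :=
  LinearMap.toSpanSingleton (Env K s) M v ∘ₗ incl K s i k

theorem homOf_gen {M : Type*} [AddCommGroup M] [Module (Env K s) M] (i k : ZMod s) (v : M) :
    homOf K s i k v (BiProj.gen K s i k) =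
      Env.tmul K s (e K s i) (e K s k) • v := rfl

/-! ### The complex -/

/-- `Qⁿ = ⨁_{i = 0}^{s-1} ⨁_{j = 0}^{n} Λ_s e_i ⊗ e_{i+n} Λ_s`; the index `(i, j)` stands for the
element `g^n_{i,j}`, whose origin is `e_i` and whose terminus is `e_{i+n}`. -/
abbrev Q (n : ℕ) : Type _ :=
  ⨁ p : ZMod s × Fin (n + 1), BiProj K s p.1 (p.1 + (n : ZMod s))

/-- The generator `b^n_{i,j}` of `Qⁿ`. -/
def b (n : ℕ) (i : ZMod s) (j : Fin (n + 1)) : Q K s n :=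
  DirectSum.lof (Env K s) (ZMod s × Fin (n + 1))
    (fun p => BiProj K s p.1 (p.1 + (n : ZMod s))) (i, j) (BiProj.gen K s i (i + (n : ZMod s)))

/-- The left multiplication `a v` in a bimodule. -/
def lmul {M : Type*} [AddCommGroup M] [Module (Env K s) M] (a : Lam K s) (v : M) : M :=
  Env.tmul K s a 1 • v

/-- The right multiplication `v a` in a bimodule. -/
def rmul {M : Type*} [AddCommGroup M] [Module (Env K s) M] (v : M) (a : Lam K s) : M :=
  Env.tmul K s 1 a • v

/-- The image of `b^{n+1}_{i,j}` under `∂^{n+1}`. -/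
def dGen (n : ℕ) (i : ZMod s) (j : Fin (n + 2)) : Q K s n :=
  if h0 : (j : ℕ) = 0 then
    rmul K s (b K s n i ⟨0, by omega⟩) (y K s) +
      (-1 : ℤ) ^ (n + 1) • lmul K s (y K s) (b K s n (i + 1) ⟨0, by omega⟩)
  else if hn : (j : ℕ) = n + 1 then
    rmul K s (b K s n i ⟨n, by omega⟩) (x K s) +
      (-1 : ℤ) ^ (n + 1) • lmul K s (x K s) (b K s n (i + 1) ⟨n, by omega⟩)
  else
    (rmul K s (b K s n i ⟨j - 1, by omega⟩) (x K s) +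
      rmul K s (b K s n i ⟨j, by omega⟩) (y K s)) +
      (-1 : ℤ) ^ (n + 1) •
        (lmul K s (y K s) (b K s n (i + 1) ⟨j, by omega⟩) +
          lmul K s (x K s) (b K s n (i + 1) ⟨j - 1, by omega⟩))

/-- `∂⁰ : Q⁰ → Λ_s`, the multiplication map `u ⊗ w ↦ u w` on every summand. -/
def d0 : Q K s 0 →ₗ[Env K s] Lam K s :=
  DirectSum.toModule (Env K s) (ZMod s × Fin (0 + 1)) (Lam K s)
    fun p => homOf K s p.1 (p.1 + ((0 : ℕ) : ZMod s)) (1 : Lam K s)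

/-- `∂^{n+1} : Q^{n+1} → Qⁿ`, the bimodule homomorphism with `b^{n+1}_{i,j} ↦ dGen n i j`. -/
def d (n : ℕ) : Q K s (n + 1) →ₗ[Env K s] Q K s n :=
  DirectSum.toModule (Env K s) (ZMod s × Fin (n + 1 + 1)) (Q K s n)
    fun p => homOf K s p.1 (p.1 + ((n + 1 : ℕ) : ZMod s)) (dGen K s n p.1 p.2)

theorem d0_tmul (p : ZMod s × Fin (0 + 1)) (u : leftProj K s p.1)
    (w : rightProj K s (p.1 + ((0 : ℕ) : ZMod s))) :
    d0 K s (DirectSum.lof (Env K s) (ZMod s × Fin (0 + 1))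
      (fun p => BiProj K s p.1 (p.1 + ((0 : ℕ) : ZMod s))) p (BiProj.tmul K s u w)) =
      (u : Lam K s) * (w : Lam K s) := by
  rw [d0, DirectSum.toModule_lof, homOf, LinearMap.comp_apply, incl_tmul,
    LinearMap.toSpanSingleton_apply, Env.tmul_smul, mul_one]

theorem smul_b (n : ℕ) (i : ZMod s) (j : Fin (n + 1)) :
    Env.tmul K s (e K s i) (e K s (i + (n : ZMod s))) • b K s n i j = b K s n i j := by
  rw [b, ← map_smul, BiProj.smul_gen]

theorem smul_rmul {M : Type*} [AddCommGroup M] [Module (Env K s) M] {i k : ZMod s} {v : M}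
    (hv : Env.tmul K s (e K s i) (e K s k) • v = v) {z : Lam K s}
    (hz : ∀ i, e K s i * z = z * e K s (i + 1)) :
    Env.tmul K s (e K s i) (e K s (k + 1)) • rmul K s v z = rmul K s v z := by
  rw [← hv, rmul, smul_smul, smul_smul, smul_smul]
  simp only [Env.tmul_mul_tmul, one_mul, mul_one, e_mul_e]
  rw [← hz, ← mul_assoc, e_mul_e]

theorem smul_lmul {M : Type*} [AddCommGroup M] [Module (Env K s) M] {i k : ZMod s} {v : M}
    (hv : Env.tmul K s (e K s (i + 1)) (e K s k) • v = v) {z : Lam K s}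
    (hz : ∀ i, e K s i * z = z * e K s (i + 1)) :
    Env.tmul K s (e K s i) (e K s k) • lmul K s z v = lmul K s z v := by
  rw [← hv, lmul, smul_smul, smul_smul, smul_smul]
  simp only [Env.tmul_mul_tmul, one_mul, mul_one, e_mul_e]
  rw [hz, mul_assoc, e_mul_e]

theorem smul_rmul_b (n : ℕ) (i : ZMod s) (j : Fin (n + 1)) {z : Lam K s}
    (hz : ∀ i, e K s i * z = z * e K s (i + 1)) :
    Env.tmul K s (e K s i) (e K s (i + ((n + 1 : ℕ) : ZMod s))) • rmul K s (b K s n i j) z =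
      rmul K s (b K s n i j) z := by
  rw [Nat.cast_add, Nat.cast_one, ← add_assoc]
  exact smul_rmul K s (smul_b K s n i j) hz

theorem smul_lmul_b (n : ℕ) (i : ZMod s) (j : Fin (n + 1)) {z : Lam K s}
    (hz : ∀ i, e K s i * z = z * e K s (i + 1)) :
    Env.tmul K s (e K s i) (e K s (i + ((n + 1 : ℕ) : ZMod s))) •
      lmul K s z (b K s n (i + 1) j) = lmul K s z (b K s n (i + 1) j) := by
  have h : i + ((n + 1 : ℕ) : ZMod s) = i + 1 + (n : ZMod s) := by push_cast; ring
  rw [h]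
  exact smul_lmul K s (smul_b K s n (i + 1) j) hz

/-- `∂^{n+1}` has the prescribed values on the generators. -/
theorem d_b (n : ℕ) (i : ZMod s) (j : Fin (n + 2)) :
    d K s n (b K s (n + 1) i j) = dGen K s n i j := by
  rw [d, b, DirectSum.toModule_lof, homOf_gen, dGen]
  split_ifs <;>
    simp only [smul_add, smul_comm _ ((-1 : ℤ) ^ (n + 1)), smul_rmul_b K s n i _ (e_mul_x K s),
      smul_rmul_b K s n i _ (e_mul_y K s), smul_lmul_b K s n i _ (e_mul_x K s),
      smul_lmul_b K s n i _ (e_mul_y K s)]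

end Lam

/-! ### Minimal projective resolutions -/

/-- A submodule `L` of `M` is superfluous if `L + X = M` implies `X = M`. -/
def IsSuperfluous {R M : Type*} [Ring R] [AddCommGroup M] [Module R M] (L : Submodule R M) :
    Prop :=
  ∀ X : Submodule R M, L ⊔ X = ⊤ → X = ⊤

/-- A homomorphism `f : P → M` is a projective cover of `M` if `P` is projective and `f` is an
epimorphism with superfluous kernel. -/
structure IsProjectiveCover {R P M : Type*} [Ring R] [AddCommGroup P] [Module R P]
    [AddCommGroup M] [Module R M] (f : P →ₗ[R] M) : Prop where
  projective : Module.Projective R P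
  surjective : Function.Surjective f
  superfluous : IsSuperfluous (LinearMap.ker f)

/-- The sequence `⋯ → P 2 → P 1 → P 0 → M → 0` with maps `d n : P (n + 1) → P n` and
`ε : P 0 → M` is a minimal projective resolution of `M`: it is exact, `ε` is a projective cover
of `M`, and each `d n` is a projective cover of its image. -/
structure IsMinimalProjectiveResolution {R M : Type*} {P : ℕ → Type*} [Ring R]
    [AddCommGroup M] [Module R M] [∀ n, AddCommGroup (P n)] [∀ n, Module R (P n)]
    (ε : P 0 →ₗ[R] M) (d : ∀ n, P (n + 1) →ₗ[R] P n) : Prop where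
  exact_zero : Function.Exact (d 0) ε
  exact_succ : ∀ n, Function.Exact (d (n + 1)) (d n)
  cover_zero : IsProjectiveCover ε
  cover_succ : ∀ n, IsProjectiveCover (d n).rangeRestrict

end

/-! `Λ_s` is a cyclic version of the exterior algebra on `x` and `y`, and `Q` is its Koszul-type
bimodule resolution. The shift of vertices is bookkeeping: with `η_n = ∑ e_i ⊗ e_{i+n}`, `Qⁿ` is the
direct summand `F_n η_n` of the free module `F_n = (Env K s)^{n+1}`. The differential of `F` is
right multiplication by `diffX = 1 ⊗ x ± x ⊗ 1` and `diffY = 1 ⊗ y ± y ⊗ 1`. Both `projQ` and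
`inclQ` are chain maps (`d_projQ`, `inclQ_d`), because `e_i x = x e_{i+1}` and `e_i y = y e_{i+1}`.

Exactness of `F` in positive degrees (`exists_dFree_eq`) comes from an explicit homotopy. Skew
derivations of `Λ_s` along `x` and `y`, applied to the right tensor factor, contract the part of the
differential that acts on that factor. The other part changes sign with the degree and commutes with
the homotopy, so it cancels, except in component 0, where a multiple of `x ⊗ 1` remains. As `x² =
0`, a second application of the homotopy removes this error. The skew derivations exist by the
universal property of `Λ_s`, so no basis of `Λ_s` is needed.

At `Q⁰`, exactness says that modulo the image of `∂¹` every factor can be moved across the tensor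
sign, which is checked on the generators `e_i`, `x`, `y`.

For minimality, `x` and `y` are normal elements of square zero, so the entries of the differentials
lie in the Jacobson radical of the enveloping algebra. By exactness the kernels are images of
differentials, hence lie in the radical of a finitely generated module and are superfluous by
Nakayama's lemma. -/

open scoped TensorProduct DirectSum

noncomputable section

namespace Lam

variable (K : Type*) [Field K] (s : ℕ) [NeZero s]

/-! ### Generators and relations of `Λ_s` -/

theorem mk_surjective : Function.Surjective (mk K s) := RingCon.mk'_surjective _

theorem mk_smul (c : K) (f : KGamma K s) : mk K s (c • f) = c • mk K s f := rfl

theorem mk_eq_zero {f : KGamma K s} (hf : f ∈ KGamma.I K s) : mk K s f = 0 := by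
  have h : f ∈ TwoSidedIdeal.ker (KGamma.I K s).ringCon.mk' :=
    (TwoSidedIdeal.ker_ringCon_mk' (KGamma.I K s)).symm ▸ hf
  exact (TwoSidedIdeal.mem_ker _).1 h

theorem x_mul_x : x K s * x K s = 0 := by
  rw [x, ← map_mul, ← pow_two]
  exact mk_eq_zero K s (TwoSidedIdeal.subset_span (by simp))

theorem y_mul_y : y K s * y K s = 0 := by
  rw [y, ← map_mul, ← pow_two]
  exact mk_eq_zero K s (TwoSidedIdeal.subset_span (by simp))

theorem y_mul_x : y K s * x K s = -(x K s * y K s) := by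
  rw [eq_neg_iff_add_eq_zero, add_comm, x, y, ← map_mul, ← map_mul, ← map_add]
  exact mk_eq_zero K s (TwoSidedIdeal.subset_span (by simp))

theorem sum_e : ∑ i, e K s i = 1 := by
  simp only [e]
  rw [← map_sum, ← PathAlgebra.one_def, map_one]

theorem e_mul_e_of_ne {i k : ZMod s} (h : i ≠ k) : e K s i * e K s k = 0 := by
  rw [e, e, ← map_mul, PathAlgebra.e, PathAlgebra.e,
    PathAlgebra.path_mul_path_of_ne K _ _ h.symm, map_zero]

theorem mk_arrow_a (i : ZMod s) :
    mk K s (PathAlgebra.arrow K (j := i + 1) (GammaArrow.a i)) = e K s i * x K s := by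
  rw [e, x, ← map_mul, KGamma.x, Finset.mul_sum]
  simp [KGamma.e_mul_arrow]

theorem mk_arrow_b (i : ZMod s) :
    mk K s (PathAlgebra.arrow K (j := i + 1) (GammaArrow.b i)) = e K s i * y K s := by
  rw [e, y, ← map_mul, KGamma.y, Finset.mul_sum]
  simp [KGamma.e_mul_arrow]

/-- An induction principle: `Λ_s` is generated as an algebra by the `e_i`, `x` and `y`. -/
theorem induction {P : Lam K s → Prop} (a : Lam K s) (he : ∀ i, P (e K s i)) (hx : P (x K s))
    (hy : P (y K s)) (h0 : P 0) (hadd : ∀ a b, P a → P b → P (a + b))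
    (hsmul : ∀ (c : K) a, P a → P (c • a)) (hmul : ∀ a b, P a → P b → P (a * b)) : P a := by
  have harrow : ∀ {k l : ZMod s} (α : k ⟶ l), P (mk K s (PathAlgebra.arrow K α)) := fun {k _} α =>
    match α with
    | GammaArrow.a _ => by rw [mk_arrow_a]; exact hmul _ _ (he k) hx
    | GammaArrow.b _ => by rw [mk_arrow_b]; exact hmul _ _ (he k) hy
  obtain ⟨f, rfl⟩ := mk_surjective K s a
  induction f using PathAlgebra.induction with
  | h0 => rwa [map_zero]
  | hadd f g hf hg => rw [map_add]; exact hadd _ _ hf hg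
  | hpath c i j p =>
    rw [mk_smul]
    refine hsmul c _ ?_
    induction p with
    | nil => exact he _
    | cons p α ih =>
      have h : PathAlgebra.path K (p.cons α) = PathAlgebra.path K p * PathAlgebra.arrow K α := by
        rw [PathAlgebra.arrow, PathAlgebra.path_mul_path]
        rfl
      rw [h, map_mul]
      exact hmul _ _ ih (harrow α)

/-- A family of elements of an algebra satisfying the defining relations of `Λ_s`. -/
structure Relations {s : ℕ} [NeZero s] {A : Type*} [Ring A] (E : ZMod s → A) (X Y : A) :
    Prop where
  idem : ∀ i, E i * E i = E i
  ortho : ∀ i k, i ≠ k → E i * E k = 0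
  sum_eq : ∑ i, E i = 1
  mul_x : ∀ i, E i * X = X * E (i + 1)
  mul_y : ∀ i, E i * Y = Y * E (i + 1)
  x_mul_x : X * X = 0
  x_mul_y : X * Y + Y * X = 0
  y_mul_y : Y * Y = 0

/-! ### The universal property of `Λ_s` -/

section UniversalProperty

variable {s} {A : Type*} [Ring A] {E : ZMod s → A} {X Y : A}

/-- The value of an arrow. -/
def evalArrow (E : ZMod s → A) (X Y : A) : ∀ {i j : ZMod s}, GammaArrow s i j → A
  | i, _, GammaArrow.a _ => E i * X
  | i, _, GammaArrow.b _ => E i * Y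

/-- The value of a path. -/
def evalPath (E : ZMod s → A) (X Y : A) {i : ZMod s} : ∀ {j : ZMod s}, Quiver.Path i j → A
  | _, Quiver.Path.nil => E i
  | _, Quiver.Path.cons p α => evalPath E X Y p * evalArrow E X Y α

theorem E_mul_evalPath (h : Relations E X Y) {i j : ZMod s} (p : Quiver.Path i j) :
    E i * evalPath E X Y p = evalPath E X Y p := by
  induction p with
  | nil => exact h.idem _
  | cons p α ih => rw [evalPath, ← mul_assoc, ih]

theorem evalArrow_mul_E (h : Relations E X Y) {i j : ZMod s} (α : GammaArrow s i j) :
    evalArrow E X Y α * E j = evalArrow E X Y α := by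
  cases α with
  | a => rw [evalArrow, h.mul_x, mul_assoc, h.idem]
  | b => rw [evalArrow, h.mul_y, mul_assoc, h.idem]

theorem E_mul_evalArrow (h : Relations E X Y) {i j : ZMod s} (α : GammaArrow s i j) :
    E i * evalArrow E X Y α = evalArrow E X Y α := by
  cases α with
  | a => rw [evalArrow, ← mul_assoc, h.idem]
  | b => rw [evalArrow, ← mul_assoc, h.idem]

theorem evalPath_mul_E (h : Relations E X Y) {i j : ZMod s} (p : Quiver.Path i j) :
    evalPath E X Y p * E j = evalPath E X Y p := by
  cases p with
  | nil => exact h.idem _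
  | cons p α => rw [evalPath, mul_assoc, evalArrow_mul_E h]

theorem evalPath_comp (h : Relations E X Y) {i j k : ZMod s} (p : Quiver.Path i j)
    (q : Quiver.Path j k) :
    evalPath E X Y (p.comp q) = evalPath E X Y p * evalPath E X Y q := by
  induction q with
  | nil => exact (evalPath_mul_E h p).symm
  | cons q α ih => rw [Quiver.Path.comp_cons, evalPath, evalPath, ih, mul_assoc]

variable [Algebra K A]

/-- The linear map `K Γ_s → A` that extends the evaluation of paths. -/
def evalLin (E : ZMod s → A) (X Y : A) : KGamma K s →ₗ[K] A :=
  PathAlgebra.lift K fun p => evalPath E X Y p.2.2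

theorem evalLin_path {i j : ZMod s} (p : Quiver.Path i j) :
    evalLin K E X Y (PathAlgebra.path K p) = evalPath E X Y p :=
  PathAlgebra.lift_path K _ p

theorem evalLin_mul (h : Relations E X Y) (f g : KGamma K s) :
    evalLin K E X Y (f * g) = evalLin K E X Y f * evalLin K E X Y g := by
  induction f using PathAlgebra.induction with
  | h0 => simp
  | hadd f f' hf hf' => rw [add_mul, map_add, map_add, add_mul, hf, hf']
  | hpath c i j p =>
    induction g using PathAlgebra.induction with
    | h0 => simp
    | hadd g g' hg hg' => rw [mul_add, map_add, map_add, mul_add, hg, hg']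
    | hpath c' k l q =>
      rw [smul_mul_smul_comm, map_smul, map_smul, map_smul, smul_mul_smul_comm, evalLin_path,
        evalLin_path]
      congr 1
      by_cases hjk : k = j
      · subst hjk
        rw [PathAlgebra.path_mul_path, evalLin_path, evalPath_comp h]
      · rw [PathAlgebra.path_mul_path_of_ne K p q hjk, map_zero, ← evalPath_mul_E h p,
          ← E_mul_evalPath h q, mul_assoc, ← mul_assoc (E j), h.ortho j k (Ne.symm hjk), zero_mul,
          mul_zero]

theorem evalLin_e (i : ZMod s) : evalLin K E X Y (PathAlgebra.e K i) = E i := by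
  rw [PathAlgebra.e, evalLin_path, evalPath]

theorem evalLin_arrow (h : Relations E X Y) {i j : ZMod s} (α : i ⟶ j) :
    evalLin K E X Y (PathAlgebra.arrow K α) = evalArrow E X Y α := by
  rw [PathAlgebra.arrow, evalLin_path, Quiver.Hom.toPath, evalPath, evalPath,
    E_mul_evalArrow h]

/-- The homomorphism `K Γ_s → A` given by elements satisfying the relations. -/
def evalHom (h : Relations E X Y) : KGamma K s →+* A where
  toFun := evalLin K E X Y
  map_one' := by
    rw [PathAlgebra.one_def, map_sum, ← h.sum_eq]
    exact Finset.sum_congr rfl fun i _ => evalLin_e K i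
  map_mul' := evalLin_mul K h
  map_zero' := map_zero _
  map_add' := map_add _

theorem evalHom_e (h : Relations E X Y) (i : ZMod s) :
    evalHom K h (PathAlgebra.e K i) = E i := evalLin_e K i

theorem evalHom_x (h : Relations E X Y) : evalHom K h (KGamma.x K s) = X := by
  have hs : ∑ i, E i * X = X := by rw [← Finset.sum_mul, h.sum_eq, one_mul]
  rw [KGamma.x, map_sum]
  exact (Finset.sum_congr rfl fun i _ => evalLin_arrow K h _).trans hs

theorem evalHom_y (h : Relations E X Y) : evalHom K h (KGamma.y K s) = Y := by
  have hs : ∑ i, E i * Y = Y := by rw [← Finset.sum_mul, h.sum_eq, one_mul]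
  rw [KGamma.y, map_sum]
  exact (Finset.sum_congr rfl fun i _ => evalLin_arrow K h _).trans hs

theorem I_le_ker_evalHom (h : Relations E X Y) :
    KGamma.I K s ≤ TwoSidedIdeal.ker (evalHom K h) := by
  rw [KGamma.I, TwoSidedIdeal.span_le]
  rintro f (rfl | rfl | rfl) <;>
    simp only [SetLike.mem_coe, TwoSidedIdeal.mem_ker, pow_two, map_add, map_mul, evalHom_x,
      evalHom_y, h.x_mul_x, h.x_mul_y, h.y_mul_y]

/-- The universal property of `Λ_s`. -/
def liftHom (h : Relations E X Y) : Lam K s →+* A :=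
  RingCon.lift (KGamma.I K s).ringCon (evalHom K h) fun f g hfg => by
    have hfg := I_le_ker_evalHom K h ((TwoSidedIdeal.rel_iff _ f g).1 hfg)
    rw [TwoSidedIdeal.mem_ker, map_sub, sub_eq_zero] at hfg
    exact hfg

theorem liftHom_e (h : Relations E X Y) (i : ZMod s) : liftHom K h (e K s i) = E i :=
  evalHom_e K h i

theorem liftHom_x (h : Relations E X Y) : liftHom K h (x K s) = X := evalHom_x K h

theorem liftHom_y (h : Relations E X Y) : liftHom K h (y K s) = Y := evalHom_y K h

theorem liftHom_smul (h : Relations E X Y) (c : K) (a : Lam K s) :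
    liftHom K h (c • a) = c • liftHom K h a := by
  obtain ⟨f, rfl⟩ := mk_surjective K s a
  exact map_smul (evalLin K E X Y) c f

end UniversalProperty

/-! ### Skew derivations of `Λ_s` -/

/-- These are the matrices `[[σ a, D a], [0, a]]` for `a = e_i, x, y`; multiplicativity of such a
matrix in `a` is the skew Leibniz rule for `D`. The signs in `σ` make the off-diagonal terms of
`x²`, `xy + yx` and `y²` cancel. The shift `i + 1` in the corner is what `e_i x = x e_{i+1}`
requires there. -/
theorem relations_matrix (α β : K) :
    Relations (fun i => !![e K s (i + 1), 0; 0, e K s i])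
      !![-x K s, algebraMap K _ α; 0, x K s] !![-y K s, algebraMap K _ β; 0, y K s] where
  idem i := by simp [e_mul_e]
  ortho i k h := by
    have h' : i + 1 ≠ k + 1 := fun hh => h (add_right_cancel hh)
    simp only [Matrix.mul_fin_two, e_mul_e_of_ne K s h, e_mul_e_of_ne K s h']
    ext i j; fin_cases i <;> fin_cases j <;> simp
  sum_eq := by
    ext i j
    fin_cases i <;> fin_cases j <;>
      simp [Matrix.sum_apply, sum_e]
    exact (Equiv.sum_comp (Equiv.addRight (1 : ZMod s)) (e K s)).trans (sum_e K s)
  mul_x i := by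
    simp [e_mul_x, ← Algebra.smul_def, ← Algebra.commutes α (e K s (i + 1))]
  mul_y i := by
    simp [e_mul_y, ← Algebra.smul_def, ← Algebra.commutes β (e K s (i + 1))]
  x_mul_x := by
    simp only [Matrix.mul_fin_two, Algebra.commutes α (x K s)]
    ext i j; fin_cases i <;> fin_cases j <;> simp [x_mul_x]
  x_mul_y := by
    simp only [Matrix.mul_fin_two, Algebra.commutes α (y K s), Algebra.commutes β (x K s)]
    ext i j; fin_cases i <;> fin_cases j <;> simp [y_mul_x]
  y_mul_y := by
    simp only [Matrix.mul_fin_two, Algebra.commutes β (y K s)]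
    ext i j; fin_cases i <;> fin_cases j <;> simp [y_mul_y]

/-- The skew derivation `D` of `Λ_s` with `D e_i = 0`, `D x = α` and `D y = β`, where
`D (a b) = D a b + σ a D b` for the automorphism `σ` with `e_i ↦ e_{i+1}`, `x ↦ -x`, `y ↦ -y`. -/
def skewDer (α β : K) : Lam K s →ₗ[K] Lam K s where
  toFun a := liftHom K (relations_matrix K s α β) a 0 1
  map_add' a b := by rw [map_add, Matrix.add_apply]
  map_smul' c a := by rw [liftHom_smul, Matrix.smul_apply, RingHom.id_apply]

theorem liftHom_matrix_one (α β : K) (a : Lam K s) :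
    liftHom K (relations_matrix K s α β) a 1 0 = 0 ∧
      liftHom K (relations_matrix K s α β) a 1 1 = a := by
  induction a using Lam.induction with
  | he i => simp [liftHom_e]
  | hx => simp [liftHom_x]
  | hy => simp [liftHom_y]
  | h0 => simp
  | hadd a b ha hb => simp [ha, hb]
  | hsmul c a ha => simp [liftHom_smul, ha]
  | hmul a b ha hb => simp [Matrix.mul_apply, Fin.sum_univ_two, ha, hb]

theorem skewDer_x_mul (α β : K) (a : Lam K s) :
    skewDer K s α β (x K s * a) = α • a - x K s * skewDer K s α β a := by
  have h := (liftHom_matrix_one K s α β a).2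
  simp only [skewDer, LinearMap.coe_mk, AddHom.coe_mk, map_mul, Matrix.mul_apply,
    Fin.sum_univ_two, h, liftHom_x, Algebra.smul_def]
  simp
  abel

theorem skewDer_y_mul (α β : K) (a : Lam K s) :
    skewDer K s α β (y K s * a) = β • a - y K s * skewDer K s α β a := by
  have h := (liftHom_matrix_one K s α β a).2
  simp only [skewDer, LinearMap.coe_mk, AddHom.coe_mk, map_mul, Matrix.mul_apply,
    Fin.sum_univ_two, h, liftHom_y, Algebra.smul_def]
  simp
  abel

/-- The skew derivation with respect to `x`. -/
def derX : Lam K s →ₗ[K] Lam K s := skewDer K s 1 0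

/-- The skew derivation with respect to `y`, restricted to the part of `Λ_s` without `x`. -/
def derY : Lam K s →ₗ[K] Lam K s :=
  skewDer K s 0 1 ∘ₗ derX K s ∘ₗ LinearMap.mulLeft K (x K s)

theorem derX_x_mul (a : Lam K s) : derX K s (x K s * a) = a - x K s * derX K s a := by
  rw [derX, skewDer_x_mul, one_smul]

theorem derX_y_mul (a : Lam K s) : derX K s (y K s * a) = -(y K s * derX K s a) := by
  rw [derX, skewDer_y_mul, zero_smul, zero_sub]

theorem derY_x_mul (a : Lam K s) : derY K s (x K s * a) = 0 := by
  simp only [derY, LinearMap.comp_apply, LinearMap.mulLeft_apply]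
  rw [← mul_assoc, x_mul_x, zero_mul, map_zero, map_zero]

/-- The operator `a ↦ derX (x a)` projects onto the part of `Λ_s` without `x`. It commutes with left
multiplication by `y`, because the signs from `xy = -yx` and from the skew Leibniz rule cancel. -/
theorem derY_y_mul (a : Lam K s) :
    derY K s (y K s * a) = derX K s (x K s * a) - y K s * derY K s a := by
  simp only [derY, LinearMap.comp_apply, LinearMap.mulLeft_apply]
  rw [← mul_assoc, eq_neg_of_add_eq_zero_left (show x K s * y K s + y K s * x K s = 0 by
    rw [y_mul_x, add_neg_cancel]), neg_mul, mul_assoc, map_neg, derX_y_mul, neg_neg,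
    skewDer_y_mul, one_smul]

/-! ### Normality of `x` and `y` -/

theorem exists_x_mul_eq (a : Lam K s) : ∃ a', x K s * a = a' * x K s := by
  induction a using Lam.induction with
  | he i => exact ⟨e K s (i - 1), by rw [e_mul_x, sub_add_cancel]⟩
  | hx => exact ⟨x K s, rfl⟩
  | hy => exact ⟨-y K s, by rw [neg_mul, y_mul_x, neg_neg]⟩
  | h0 => exact ⟨0, by simp⟩
  | hadd a b ha hb =>
    obtain ⟨a', ha⟩ := ha
    obtain ⟨b', hb⟩ := hb
    exact ⟨a' + b', by rw [mul_add, ha, hb, add_mul]⟩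
  | hsmul c a ha =>
    obtain ⟨a', ha⟩ := ha
    exact ⟨c • a', by rw [mul_smul_comm, ha, smul_mul_assoc]⟩
  | hmul a b ha hb =>
    obtain ⟨a', ha⟩ := ha
    obtain ⟨b', hb⟩ := hb
    exact ⟨a' * b', by rw [← mul_assoc, ha, mul_assoc, hb, mul_assoc]⟩

theorem exists_y_mul_eq (a : Lam K s) : ∃ a', y K s * a = a' * y K s := by
  induction a using Lam.induction with
  | he i => exact ⟨e K s (i - 1), by rw [e_mul_y, sub_add_cancel]⟩
  | hx => exact ⟨-x K s, by rw [neg_mul, y_mul_x]⟩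
  | hy => exact ⟨y K s, rfl⟩
  | h0 => exact ⟨0, by simp⟩
  | hadd a b ha hb =>
    obtain ⟨a', ha⟩ := ha
    obtain ⟨b', hb⟩ := hb
    exact ⟨a' + b', by rw [mul_add, ha, hb, add_mul]⟩
  | hsmul c a ha =>
    obtain ⟨a', ha⟩ := ha
    exact ⟨c • a', by rw [mul_smul_comm, ha, smul_mul_assoc]⟩
  | hmul a b ha hb =>
    obtain ⟨a', ha⟩ := ha
    obtain ⟨b', hb⟩ := hb
    exact ⟨a' * b', by rw [← mul_assoc, ha, mul_assoc, hb, mul_assoc]⟩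

theorem exists_mul_x_eq (a : Lam K s) : ∃ a', a * x K s = x K s * a' := by
  induction a using Lam.induction with
  | he i => exact ⟨_, e_mul_x K s i⟩
  | hx => exact ⟨x K s, rfl⟩
  | hy => exact ⟨-y K s, by rw [mul_neg, y_mul_x]⟩
  | h0 => exact ⟨0, by simp⟩
  | hadd a b ha hb =>
    obtain ⟨a', ha⟩ := ha
    obtain ⟨b', hb⟩ := hb
    exact ⟨a' + b', by rw [add_mul, ha, hb, mul_add]⟩
  | hsmul c a ha =>
    obtain ⟨a', ha⟩ := ha
    exact ⟨c • a', by rw [mul_smul_comm, ← ha, smul_mul_assoc]⟩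
  | hmul a b ha hb =>
    obtain ⟨a', ha⟩ := ha
    obtain ⟨b', hb⟩ := hb
    exact ⟨a' * b', by rw [mul_assoc, hb, ← mul_assoc, ha, mul_assoc]⟩

theorem exists_mul_y_eq (a : Lam K s) : ∃ a', a * y K s = y K s * a' := by
  induction a using Lam.induction with
  | he i => exact ⟨_, e_mul_y K s i⟩
  | hx => exact ⟨-x K s, by rw [mul_neg, y_mul_x, neg_neg]⟩
  | hy => exact ⟨y K s, rfl⟩
  | h0 => exact ⟨0, by simp⟩
  | hadd a b ha hb =>
    obtain ⟨a', ha⟩ := ha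
    obtain ⟨b', hb⟩ := hb
    exact ⟨a' + b', by rw [add_mul, ha, hb, mul_add]⟩
  | hsmul c a ha =>
    obtain ⟨a', ha⟩ := ha
    exact ⟨c • a', by rw [mul_smul_comm, ← ha, smul_mul_assoc]⟩
  | hmul a b ha hb =>
    obtain ⟨a', ha⟩ := ha
    obtain ⟨b', hb⟩ := hb
    exact ⟨a' * b', by rw [mul_assoc, hb, ← mul_assoc, ha, mul_assoc]⟩

/-! ### The enveloping algebra -/

namespace Env

theorem add_tmul (a a' b : Lam K s) : tmul K s (a + a') b = tmul K s a b + tmul K s a' b :=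
  TensorProduct.add_tmul a a' (MulOpposite.op b)

theorem tmul_add (a b b' : Lam K s) : tmul K s a (b + b') = tmul K s a b + tmul K s a b' :=
  TensorProduct.tmul_add a (MulOpposite.op b) (MulOpposite.op b')

theorem smul_tmul (c : K) (a b : Lam K s) : tmul K s (c • a) b = tmul K s a (c • b) :=
  TensorProduct.smul_tmul c a (MulOpposite.op b)

theorem zero_tmul (b : Lam K s) : tmul K s 0 b = 0 :=
  TensorProduct.zero_tmul (Lam K s) (MulOpposite.op b)

theorem tmul_zero (a : Lam K s) : tmul K s a 0 = 0 :=
  TensorProduct.tmul_zero (Lam K s)ᵐᵒᵖ a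

theorem neg_tmul (a b : Lam K s) : tmul K s (-a) b = -tmul K s a b := by
  rw [eq_neg_iff_add_eq_zero, ← add_tmul, neg_add_cancel, zero_tmul]

theorem tmul_neg (a b : Lam K s) : tmul K s a (-b) = -tmul K s a b := by
  rw [eq_neg_iff_add_eq_zero, ← tmul_add, neg_add_cancel, tmul_zero]

theorem tmul_sub (a b b' : Lam K s) : tmul K s a (b - b') = tmul K s a b - tmul K s a b' := by
  rw [sub_eq_add_neg, tmul_add, tmul_neg, sub_eq_add_neg]

/-- The additive map `a ⊗ w ↦ a ⊗ T w` for a linear map `T`. -/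
def mapRight (T : Lam K s →ₗ[K] Lam K s) : Env K s →+ Env K s :=
  (TensorProduct.map LinearMap.id ((MulOpposite.opLinearEquiv K).toLinearMap ∘ₗ T ∘ₗ
    (MulOpposite.opLinearEquiv K).symm.toLinearMap) :
      Lam K s ⊗[K] (Lam K s)ᵐᵒᵖ →ₗ[K] Lam K s ⊗[K] (Lam K s)ᵐᵒᵖ).toAddMonoidHom

theorem mapRight_tmul (T : Lam K s →ₗ[K] Lam K s) (a b : Lam K s) :
    mapRight K s T (tmul K s a b) = tmul K s a (T b) := rfl

/-- Right multiplication by `a ⊗ 1` touches only the left factor, so operators on the right factor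
commute with it. -/
theorem mapRight_mul_tmul_one (T : Lam K s →ₗ[K] Lam K s) (c : Env K s) (a : Lam K s) :
    mapRight K s T (c * tmul K s a 1) = mapRight K s T c * tmul K s a 1 := by
  induction c using Env.induction with
  | h0 => simp
  | hadd c d hc hd => rw [add_mul, map_add, map_add, add_mul, hc, hd]
  | htmul u w => simp only [tmul_mul_tmul, mapRight_tmul, one_mul]

/-- The element `x ⊗ 1`. -/
def lx : Env K s := tmul K s (x K s) 1

/-- The element `y ⊗ 1`. -/
def ly : Env K s := tmul K s (y K s) 1

/-- The element `1 ⊗ op x`. -/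
def rx : Env K s := tmul K s 1 (x K s)

/-- The element `1 ⊗ op y`. -/
def ry : Env K s := tmul K s 1 (y K s)

theorem lx_mul_lx : lx K s * lx K s = 0 := by
  simp only [lx, tmul_mul_tmul, x_mul_x, zero_tmul]

theorem ly_mul_ly : ly K s * ly K s = 0 := by
  simp only [ly, tmul_mul_tmul, y_mul_y, zero_tmul]

theorem rx_mul_rx : rx K s * rx K s = 0 := by
  simp only [rx, tmul_mul_tmul, x_mul_x, tmul_zero]

theorem ry_mul_ry : ry K s * ry K s = 0 := by
  simp only [ry, tmul_mul_tmul, y_mul_y, tmul_zero]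

theorem ly_mul_lx : ly K s * lx K s = -(lx K s * ly K s) := by
  simp only [lx, ly, tmul_mul_tmul, y_mul_x, neg_tmul]

theorem ry_mul_rx : ry K s * rx K s = -(rx K s * ry K s) := by
  simp only [rx, ry, tmul_mul_tmul, y_mul_x, tmul_neg, neg_neg]

theorem commute_tmul (a b : Lam K s) : Commute (tmul K s 1 b) (tmul K s a 1) := by
  simp only [commute_iff_eq, tmul_mul_tmul, one_mul, mul_one]

theorem rx_mul_lx : rx K s * lx K s = lx K s * rx K s := commute_tmul K s _ _
theorem rx_mul_ly : rx K s * ly K s = ly K s * rx K s := commute_tmul K s _ _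
theorem ry_mul_lx : ry K s * lx K s = lx K s * ry K s := commute_tmul K s _ _
theorem ry_mul_ly : ry K s * ly K s = ly K s * ry K s := commute_tmul K s _ _

/-- The homotopy with respect to `x`. -/
def hX : Env K s →+ Env K s := mapRight K s (derX K s)

/-- The homotopy with respect to `y`. -/
def hY : Env K s →+ Env K s := mapRight K s (derY K s)

theorem hX_mul_lx (c : Env K s) : hX K s (c * lx K s) = hX K s c * lx K s :=
  mapRight_mul_tmul_one K s _ c _

theorem hX_mul_ly (c : Env K s) : hX K s (c * ly K s) = hX K s c * ly K s :=
  mapRight_mul_tmul_one K s _ c _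

theorem hY_mul_lx (c : Env K s) : hY K s (c * lx K s) = hY K s c * lx K s :=
  mapRight_mul_tmul_one K s _ c _

theorem hY_mul_ly (c : Env K s) : hY K s (c * ly K s) = hY K s c * ly K s :=
  mapRight_mul_tmul_one K s _ c _

/-- In the opposite algebra, right multiplication by `1 ⊗ op x` is left multiplication by `x` on the
right factor, so this is the rule for `derX (x a)`. -/
theorem hX_mul_rx (c : Env K s) : hX K s (c * rx K s) = c - hX K s c * rx K s := by
  induction c using Env.induction with
  | h0 => simp
  | hadd c d hc hd => rw [add_mul, map_add, map_add, add_mul, hc, hd]; abel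
  | htmul u w => simp only [hX, rx, tmul_mul_tmul, mapRight_tmul, mul_one, derX_x_mul, tmul_sub]

theorem hX_mul_ry (c : Env K s) : hX K s (c * ry K s) = -(hX K s c * ry K s) := by
  induction c using Env.induction with
  | h0 => simp
  | hadd c d hc hd => rw [add_mul, map_add, map_add, add_mul, hc, hd]; abel
  | htmul u w => simp only [hX, ry, tmul_mul_tmul, mapRight_tmul, mul_one, derX_y_mul, tmul_neg]

theorem hY_mul_rx (c : Env K s) : hY K s (c * rx K s) = 0 := by
  induction c using Env.induction with
  | h0 => simp
  | hadd c d hc hd => rw [add_mul, map_add, hc, hd, add_zero]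
  | htmul u w => simp only [hY, rx, tmul_mul_tmul, mapRight_tmul, derY_x_mul, tmul_zero]

/-- With `hY_mul_rx`, this is the contracting identity in component 0: the two subtracted terms are
the 0th component of the right-hand differential applied to `homotopy`. -/
theorem hY_mul_ry (c : Env K s) :
    hY K s (c * ry K s) = c - hX K s c * rx K s - hY K s c * ry K s := by
  rw [← hX_mul_rx]
  induction c using Env.induction with
  | h0 => simp
  | hadd c d hc hd => simp only [add_mul, map_add, hc, hd]; abel
  | htmul u w =>
    simp only [hX, hY, rx, ry, tmul_mul_tmul, mapRight_tmul, mul_one, derY_y_mul, tmul_sub]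

end Env

/-! ### A complex of free modules that contains `Q` as a direct summand -/

open Env

/-- The element `1 ⊗ x ± x ⊗ 1`. -/
def diffX (n : ℕ) : Env K s := rx K s + (-1 : ℤ) ^ (n + 1) • lx K s

/-- The element `1 ⊗ y ± y ⊗ 1`. -/
def diffY (n : ℕ) : Env K s := ry K s + (-1 : ℤ) ^ (n + 1) • ly K s

/-- The squares vanish, and the mixed terms cancel since left and right multiplications commute and
the sign alternates with the degree. -/
theorem diffX_mul_diffX (n : ℕ) : diffX K s (n + 1) * diffX K s n = 0 := by
  rw [diffX, diffX, pow_succ _ (n + 1)]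
  rcases neg_one_pow_eq_or ℤ (n + 1) with h | h <;> rw [h] <;>
    simp [add_mul, mul_add, lx_mul_lx, rx_mul_rx, rx_mul_lx]

theorem diffY_mul_diffY (n : ℕ) : diffY K s (n + 1) * diffY K s n = 0 := by
  rw [diffY, diffY, pow_succ _ (n + 1)]
  rcases neg_one_pow_eq_or ℤ (n + 1) with h | h <;> rw [h] <;>
    simp [add_mul, mul_add, ly_mul_ly, ry_mul_ry, ry_mul_ly]

theorem diffY_mul_diffX (n : ℕ) :
    diffY K s (n + 1) * diffX K s n = -(diffX K s (n + 1) * diffY K s n) := by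
  rw [diffX, diffX, diffY, diffY, pow_succ _ (n + 1)]
  rcases neg_one_pow_eq_or ℤ (n + 1) with h | h <;> rw [h] <;>
    simp [add_mul, mul_add, ly_mul_lx, ry_mul_rx, ry_mul_lx, rx_mul_ly] <;> abel

/-- The differential of the complex of free modules. -/
def dFree (n : ℕ) : (Fin (n + 2) → Env K s) →ₗ[Env K s] (Fin (n + 1) → Env K s) where
  toFun f j := f j.succ * diffX K s n + f j.castSucc * diffY K s n
  map_add' f g := by ext j; simp only [Pi.add_apply, add_mul]; abel
  map_smul' c f := by
    ext j
    simp only [Pi.smul_apply, smul_eq_mul, RingHom.id_apply, mul_assoc, mul_add]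

theorem dFree_apply (n : ℕ) (f : Fin (n + 2) → Env K s) (j : Fin (n + 1)) :
    dFree K s n f j = f j.succ * diffX K s n + f j.castSucc * diffY K s n := rfl

theorem dFree_dFree (n : ℕ) (f : Fin (n + 3) → Env K s) :
    dFree K s n (dFree K s (n + 1) f) = 0 := by
  ext j
  simp only [dFree_apply, add_mul, mul_assoc, diffX_mul_diffX, diffY_mul_diffY, diffY_mul_diffX,
    Fin.succ_castSucc]
  simp

/-- A homotopy for the part of the differential that acts on the right tensor factors. -/
def homotopy (n : ℕ) (f : Fin (n + 1) → Env K s) : Fin (n + 2) → Env K s :=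
  Fin.cons (hY K s (f 0)) fun j => hX K s (f j)

theorem homotopy_zero (n : ℕ) (f : Fin (n + 1) → Env K s) :
    homotopy K s n f 0 = hY K s (f 0) := rfl

theorem homotopy_succ (n : ℕ) (f : Fin (n + 1) → Env K s) (j : Fin (n + 1)) :
    homotopy K s n f j.succ = hX K s (f j) := rfl

/-- Component 0 of the homotopy uses `hY` where the others use `hX`. Hence the `lx` terms of `d h`
and `h d` involve `hX (f 0)` and `hY (f 1)` and do not cancel, while the `ly` terms do. -/
theorem dFree_homotopy_zero (n : ℕ) (f : Fin (n + 2) → Env K s) (hf : dFree K s n f 0 = 0) :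
    dFree K s (n + 1) (homotopy K s (n + 1) f) 0 =
      f 0 + (-1 : ℤ) ^ (n + 1 + 1) • ((hX K s (f 0) - hY K s (f 1)) * lx K s) := by
  have h := congrArg (hY K s) hf
  rw [dFree_apply, map_zero] at h
  rw [dFree_apply, homotopy_succ, Fin.castSucc_zero, homotopy_zero]
  rw [Fin.castSucc_zero, Fin.succ_zero_eq_one] at h
  rw [diffX, diffY] at h ⊢
  rw [pow_succ _ (n + 1)]
  rcases neg_one_pow_eq_or ℤ (n + 1) with hn | hn <;> rw [hn] at h ⊢ <;>
    simp only [one_smul, neg_smul, mul_add, mul_neg, map_add, map_neg, hY_mul_rx, hY_mul_ry,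
      hY_mul_lx, hY_mul_ly, mul_one, neg_neg, sub_mul] at h ⊢ <;>
    -- The difference of the two sides is minus `hY` of the vanishing component of `dFree f`.
    rw [← sub_eq_zero, ← neg_eq_zero, ← h] <;> abel

theorem dFree_homotopy_succ (n : ℕ) (f : Fin (n + 2) → Env K s) (j : Fin (n + 1))
    (hf : dFree K s n f j = 0) :
    dFree K s (n + 1) (homotopy K s (n + 1) f) j.succ = f j.succ := by
  have h := congrArg (hX K s) hf
  rw [dFree_apply, map_zero] at h
  rw [dFree_apply, ← Fin.succ_castSucc, homotopy_succ, homotopy_succ]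
  rw [diffX, diffY] at h ⊢
  rw [pow_succ _ (n + 1)]
  rcases neg_one_pow_eq_or ℤ (n + 1) with hn | hn <;> rw [hn] at h ⊢ <;>
    simp only [one_smul, neg_smul, mul_add, mul_neg, map_add, map_neg, hX_mul_rx, hX_mul_ry,
      hX_mul_lx, hX_mul_ly, mul_one, neg_neg] at h ⊢ <;>
    rw [← sub_eq_zero, ← neg_eq_zero, ← h] <;> abel

theorem exists_dFree_eq (n : ℕ) (f : Fin (n + 2) → Env K s) (hf : dFree K s n f = 0) :
    ∃ g, dFree K s (n + 1) g = f := by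
  -- The error `g` is again a cycle. It lives in component 0 and is a multiple of `lx` there, so its
  -- own error term vanishes and the homotopy lifts it exactly.
  set g := dFree K s (n + 1) (homotopy K s (n + 1) f) - f with hg
  have hg0 : dFree K s n g = 0 := by rw [hg, map_sub, dFree_dFree, hf, sub_zero]
  have hgs : ∀ j : Fin (n + 1), g j.succ = 0 := fun j => by
    rw [hg, Pi.sub_apply, dFree_homotopy_succ K s n f j (congrFun hf j), sub_self]
  have hgz : g 0 * lx K s = 0 ∧ hX K s (g 0) * lx K s = 0 := by
    have h0 : g 0 = ((-1 : ℤ) ^ (n + 1 + 1) • (hX K s (f 0) - hY K s (f 1))) * lx K s := by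
      rw [hg, Pi.sub_apply, dFree_homotopy_zero K s n f (congrFun hf 0), add_sub_cancel_left,
        smul_mul_assoc]
    rw [h0, hX_mul_lx, mul_assoc, mul_assoc, lx_mul_lx, mul_zero, mul_zero]
    exact ⟨rfl, rfl⟩
  refine ⟨homotopy K s (n + 1) f - homotopy K s (n + 1) g, ?_⟩
  have hgg : dFree K s (n + 1) (homotopy K s (n + 1) g) = g := by
    ext j
    refine Fin.cases ?_ (fun j => ?_) j
    · rw [dFree_homotopy_zero K s n g (congrFun hg0 0), sub_mul, hgz.2, ← Fin.succ_zero_eq_one,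
        hgs, map_zero, zero_mul, sub_zero, smul_zero, add_zero]
    · exact dFree_homotopy_succ K s n g j (congrFun hg0 j)
  rw [map_sub, hgg, hg, sub_sub_cancel]

end Lam

/-! ### Superfluous submodules and the Jacobson radical -/

/-- Nakayama: a proper submodule of a finitely generated module lies in a maximal one, which also
contains the radical. -/
theorem isSuperfluous_of_le_jacobson {R M : Type*} [Ring R] [AddCommGroup M] [Module R M]
    [Module.Finite R M] {L : Submodule R M} (h : L ≤ Module.jacobson R M) : IsSuperfluous L := by
  intro X hX
  rcases eq_top_or_exists_le_coatom X with hX' | ⟨m, hm, hXm⟩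
  · exact hX'
  · exact absurd (top_le_iff.1 (hX ▸ sup_le (h.trans (sInf_le hm)) hXm)) hm.1

theorem mem_jacobson_of_normal {R : Type*} [Ring R] {z : R} (hz : z * z = 0)
    (hn : ∀ c, ∃ c', z * c = c' * z) : z ∈ Ring.jacobson R := by
  rw [← Ideal.jacobson_bot, Ideal.mem_jacobson_iff]
  intro c
  obtain ⟨c', hc⟩ := hn c
  -- Normality gives `(c z)² = 0`, so `1 - c z` is a left inverse of `1 + c z`.
  refine ⟨1 - c * z, ?_⟩
  have h : c * z * (c * z) = 0 := by
    rw [mul_assoc, ← mul_assoc z, hc, mul_assoc c', hz, mul_zero, mul_zero]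
  rw [Ideal.mem_bot, mul_assoc, sub_mul, one_mul, h]
  abel

namespace Lam

variable (K : Type*) [Field K] (s : ℕ) [NeZero s]

open Env

theorem lx_mem_jacobson : lx K s ∈ Ring.jacobson (Env K s) := by
  refine mem_jacobson_of_normal (lx_mul_lx K s) fun c => ?_
  induction c using Env.induction with
  | h0 => exact ⟨0, by simp⟩
  | hadd c d hc hd =>
    obtain ⟨c', hc⟩ := hc
    obtain ⟨d', hd⟩ := hd
    exact ⟨c' + d', by rw [mul_add, hc, hd, add_mul]⟩
  | htmul u w =>
    obtain ⟨u', hu⟩ := exists_x_mul_eq K s u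
    exact ⟨tmul K s u' w, by simp only [lx, tmul_mul_tmul, hu, one_mul, mul_one]⟩

theorem ly_mem_jacobson : ly K s ∈ Ring.jacobson (Env K s) := by
  refine mem_jacobson_of_normal (ly_mul_ly K s) fun c => ?_
  induction c using Env.induction with
  | h0 => exact ⟨0, by simp⟩
  | hadd c d hc hd =>
    obtain ⟨c', hc⟩ := hc
    obtain ⟨d', hd⟩ := hd
    exact ⟨c' + d', by rw [mul_add, hc, hd, add_mul]⟩
  | htmul u w =>
    obtain ⟨u', hu⟩ := exists_y_mul_eq K s u
    exact ⟨tmul K s u' w, by simp only [ly, tmul_mul_tmul, hu, one_mul, mul_one]⟩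

theorem rx_mem_jacobson : rx K s ∈ Ring.jacobson (Env K s) := by
  refine mem_jacobson_of_normal (rx_mul_rx K s) fun c => ?_
  induction c using Env.induction with
  | h0 => exact ⟨0, by simp⟩
  | hadd c d hc hd =>
    obtain ⟨c', hc⟩ := hc
    obtain ⟨d', hd⟩ := hd
    exact ⟨c' + d', by rw [mul_add, hc, hd, add_mul]⟩
  | htmul u w =>
    obtain ⟨w', hw⟩ := exists_mul_x_eq K s w
    exact ⟨tmul K s u w', by simp only [rx, tmul_mul_tmul, hw, one_mul, mul_one]⟩

theorem ry_mem_jacobson : ry K s ∈ Ring.jacobson (Env K s) := by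
  refine mem_jacobson_of_normal (ry_mul_ry K s) fun c => ?_
  induction c using Env.induction with
  | h0 => exact ⟨0, by simp⟩
  | hadd c d hc hd =>
    obtain ⟨c', hc⟩ := hc
    obtain ⟨d', hd⟩ := hd
    exact ⟨c' + d', by rw [mul_add, hc, hd, add_mul]⟩
  | htmul u w =>
    obtain ⟨w', hw⟩ := exists_mul_y_eq K s w
    exact ⟨tmul K s u w', by simp only [ry, tmul_mul_tmul, hw, one_mul, mul_one]⟩

theorem dFree_mem_jacobson (n : ℕ) (f : Fin (n + 2) → Env K s) (j : Fin (n + 1)) :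
    dFree K s n f j ∈ Ring.jacobson (Env K s) := by
  rw [dFree_apply, diffX, diffY]
  exact add_mem
    (Ideal.mul_mem_left _ _ (add_mem (rx_mem_jacobson K s) (zsmul_mem (lx_mem_jacobson K s) _)))
    (Ideal.mul_mem_left _ _ (add_mem (ry_mem_jacobson K s) (zsmul_mem (ly_mem_jacobson K s) _)))

/-! ### `Q` as a direct summand of a free complex -/

theorem BiProj.exists_smul_gen {i k : ZMod s} (z : BiProj K s i k) :
    ∃ c : Env K s, c • BiProj.gen K s i k = z := by
  induction z using BiProj.induction with
  | h0 => exact ⟨0, zero_smul _ _⟩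
  | hadd z w hz hw =>
    obtain ⟨c, rfl⟩ := hz
    obtain ⟨d, rfl⟩ := hw
    exact ⟨c + d, add_smul _ _ _⟩
  | htmul u w =>
    obtain ⟨a, ha⟩ := Submodule.mem_span_singleton.1 u.2
    obtain ⟨b, hb⟩ := Submodule.mem_span_singleton.1 w.2
    refine ⟨Env.tmul K s a b.unop, ?_⟩
    rw [BiProj.gen, BiProj.smul_tmul]
    congr 1
    · exact Subtype.ext ha
    · exact Subtype.ext hb

theorem hom_ext_b {M : Type*} [AddCommGroup M] [Module (Env K s) M] {n : ℕ}
    {f g : Q K s n →ₗ[Env K s] M} (h : ∀ i j, f (b K s n i j) = g (b K s n i j)) : f = g := by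
  refine DirectSum.linearMap_ext _ fun p => LinearMap.ext fun z => ?_
  obtain ⟨c, rfl⟩ := BiProj.exists_smul_gen K s z
  rw [map_smul, map_smul]
  exact congrArg (c • ·) (h p.1 p.2)

/-- The sum of the generators `b^n_{i,j}` over all vertices `i`. -/
def bSum (n : ℕ) (j : Fin (n + 1)) : Q K s n := ∑ i, b K s n i j

/-- The projection of the free complex onto `Q`. -/
def projQ (n : ℕ) : (Fin (n + 1) → Env K s) →ₗ[Env K s] Q K s n :=
  Fintype.linearCombination (Env K s) (bSum K s n)

theorem projQ_apply (n : ℕ) (f : Fin (n + 1) → Env K s) :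
    projQ K s n f = ∑ j, f j • bSum K s n j := rfl

/-- The inclusion of `Q` into the free complex. -/
def inclQ (n : ℕ) : Q K s n →ₗ[Env K s] (Fin (n + 1) → Env K s) :=
  DirectSum.toModule (Env K s) _ _ fun p =>
    LinearMap.single (Env K s) (fun _ => Env K s) p.2 ∘ₗ incl K s p.1 (p.1 + (n : ZMod s))

theorem inclQ_b (n : ℕ) (i : ZMod s) (j : Fin (n + 1)) :
    inclQ K s n (b K s n i j) =
      Pi.single j (Env.tmul K s (e K s i) (e K s (i + (n : ZMod s)))) := by
  rw [inclQ, b, DirectSum.toModule_lof, LinearMap.comp_apply, BiProj.gen, incl_tmul]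
  rfl

theorem tmul_e_smul_b_of_ne (n : ℕ) {i k : ZMod s} (h : k ≠ i) (a : Lam K s) (j : Fin (n + 1)) :
    Env.tmul K s (e K s k) a • b K s n i j = 0 := by
  rw [← smul_b, smul_smul, tmul_mul_tmul, e_mul_e_of_ne K s h, zero_tmul, zero_smul]

/-- The idempotent `e_i ⊗ e_{i+n}` picks `b^n_{i,j}` out of the sum `bSum K s n j`. -/
theorem projQ_inclQ (n : ℕ) : projQ K s n ∘ₗ inclQ K s n = LinearMap.id := by
  refine hom_ext_b K s fun i j => ?_
  rw [LinearMap.comp_apply, inclQ_b, projQ_apply, Finset.sum_eq_single j, Pi.single_eq_same, bSum,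
    Finset.smul_sum, Finset.sum_eq_single i, smul_b, LinearMap.id_apply]
  · intro k _ hk
    exact tmul_e_smul_b_of_ne K s n hk.symm _ j
  · simp
  · intro k _ hk
    rw [Pi.single_eq_of_ne hk, zero_smul]
  · simp

theorem projQ_inclQ_apply (n : ℕ) (z : Q K s n) : projQ K s n (inclQ K s n z) = z :=
  LinearMap.congr_fun (projQ_inclQ K s n) z

theorem projQ_surjective (n : ℕ) : Function.Surjective (projQ K s n) := fun z =>
  ⟨inclQ K s n z, projQ_inclQ_apply K s n z⟩

instance (n : ℕ) : Module.Projective (Env K s) (Q K s n) :=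
  Module.Projective.of_split (inclQ K s n) (projQ K s n) (projQ_inclQ K s n)

instance (n : ℕ) : Module.Finite (Env K s) (Q K s n) :=
  Module.Finite.of_surjective (projQ K s n) (projQ_surjective K s n)

theorem sum_rmul_b (n : ℕ) (j : Fin (n + 1)) (a : Lam K s) :
    ∑ i, rmul K s (b K s n i j) a = Env.tmul K s 1 a • bSum K s n j := by
  rw [bSum, Finset.smul_sum]
  rfl

/-- Summation over all vertices absorbs the shift `i + 1` in the left-hand terms of the
differential. -/
theorem sum_lmul_b (n : ℕ) (j : Fin (n + 1)) (a : Lam K s) :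
    ∑ i, lmul K s a (b K s n (i + 1) j) = Env.tmul K s a 1 • bSum K s n j := by
  rw [bSum, Finset.smul_sum]
  exact Equiv.sum_comp (Equiv.addRight (1 : ZMod s)) fun i => lmul K s a (b K s n i j)

/-- The three cases of `dGen` become one formula: the `x` term is absent at index 0 (the `0` of
`Fin.cons`), the `y` term at the last index (the `0` of `Fin.snoc`). -/
theorem sum_dGen (n : ℕ) (j : Fin (n + 2)) :
    ∑ i, dGen K s n i j =
      (Fin.cons 0 fun k => diffX K s n • bSum K s n k : Fin (n + 2) → Q K s n) j +
        (Fin.snoc (fun k => diffY K s n • bSum K s n k) 0 : Fin (n + 2) → Q K s n) j := by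
  refine Fin.cases ?_ (fun j => ?_) j
  · rw [Fin.cons_zero, zero_add, ← Fin.castSucc_zero, Fin.snoc_castSucc, diffY, add_smul,
      smul_assoc, ry, ly, ← sum_rmul_b, ← sum_lmul_b, Finset.smul_sum, ← Finset.sum_add_distrib]
    exact Finset.sum_congr rfl fun i _ => dif_pos rfl
  · rw [Fin.cons_succ]
    refine Fin.lastCases ?_ (fun k => ?_) j
    · rw [Fin.succ_last, Fin.snoc_last, add_zero, diffX, add_smul, smul_assoc, rx, lx,
        ← sum_rmul_b, ← sum_lmul_b, Finset.smul_sum, ← Finset.sum_add_distrib]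
      refine Finset.sum_congr rfl fun i _ => ?_
      rw [dGen, dif_neg (by simp), dif_pos (by simp)]
      rfl
    · rw [Fin.succ_castSucc, Fin.snoc_castSucc, diffX, diffY, add_smul, add_smul, smul_assoc,
        smul_assoc, rx, lx, ry, ly]
      simp only [← sum_rmul_b, ← sum_lmul_b, Finset.smul_sum, ← Finset.sum_add_distrib]
      refine Finset.sum_congr rfl fun i _ => ?_
      have hk := k.2
      rw [dGen, dif_neg (by simp), dif_neg (by simp; omega), smul_add]
      have h1 : (⟨(k.succ.castSucc : Fin (n + 2)) - 1, by simp⟩ : Fin (n + 1)) =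
          k.castSucc := Fin.ext (by simp)
      have h2 : (⟨(k.succ.castSucc : Fin (n + 2)), by simp⟩ : Fin (n + 1)) = k.succ :=
        Fin.ext (by simp)
      rw [h1, h2]
      abel

theorem d_projQ (n : ℕ) (f : Fin (n + 2) → Env K s) :
    d K s n (projQ K s (n + 1) f) = projQ K s n (dFree K s n f) := by
  have h : ∀ j, d K s n (bSum K s (n + 1) j) = ∑ i, dGen K s n i j := fun j => by
    rw [bSum, map_sum]
    exact Finset.sum_congr rfl fun i _ => d_b K s n i j
  simp only [projQ_apply, map_sum, map_smul, h, sum_dGen, smul_add, Finset.sum_add_distrib,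
    dFree_apply, add_smul, mul_smul]
  congr 1
  · simp [Fin.sum_univ_succ (n := n + 1)]
  · simp [Fin.sum_univ_castSucc (n := n + 1)]

theorem inclQ_projQ (n : ℕ) (f : Fin (n + 1) → Env K s) (j : Fin (n + 1)) :
    inclQ K s n (projQ K s n f) j =
      f j * ∑ i, Env.tmul K s (e K s i) (e K s (i + (n : ZMod s))) := by
  simp only [projQ_apply, bSum, map_sum, map_smul, inclQ_b, Finset.sum_apply, Pi.smul_apply]
  rw [Finset.sum_eq_single j]
  · simp
  · intro k _ hk
    simp [Pi.single_eq_of_ne hk.symm]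
  · simp

/-- Moving `a` past `e_{i+n+1}` in the right factor lowers its index to `i + n`. In the left factor
it raises `i` to `i + 1`, which is a reindexing of the sum. -/
theorem sum_tmul_mul_diff (n : ℕ) (ε : ℤ) {a : Lam K s}
    (ha : ∀ i, e K s i * a = a * e K s (i + 1)) :
    (∑ i, Env.tmul K s (e K s i) (e K s (i + ((n + 1 : ℕ) : ZMod s)))) *
        (Env.tmul K s 1 a + ε • Env.tmul K s a 1) =
      (Env.tmul K s 1 a + ε • Env.tmul K s a 1) *
        ∑ i, Env.tmul K s (e K s i) (e K s (i + (n : ZMod s))) := by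
  have h : ∀ i : ZMod s, i + ((n + 1 : ℕ) : ZMod s) = i + (n : ZMod s) + 1 := fun i => by
    push_cast; ring
  rw [mul_add, add_mul, mul_smul_comm, smul_mul_assoc]
  refine congrArg₂ _ ?_ (congrArg _ ?_)
  · simp only [Finset.sum_mul, Finset.mul_sum, tmul_mul_tmul, one_mul, mul_one, ha, h]
  · simp only [Finset.sum_mul, Finset.mul_sum, tmul_mul_tmul, one_mul, mul_one, ha, h]
    refine Eq.trans (Finset.sum_congr rfl fun i _ => ?_)
      (Equiv.sum_comp (Equiv.addRight (1 : ZMod s))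
        fun i => Env.tmul K s (a * e K s i) (e K s (i + (n : ZMod s))))
    rw [Equiv.coe_addRight, add_right_comm]

theorem sum_tmul_mul_diffX (n : ℕ) :
    (∑ i, Env.tmul K s (e K s i) (e K s (i + ((n + 1 : ℕ) : ZMod s)))) * diffX K s n =
      diffX K s n * ∑ i, Env.tmul K s (e K s i) (e K s (i + (n : ZMod s))) :=
  sum_tmul_mul_diff K s n _ (e_mul_x K s)

theorem sum_tmul_mul_diffY (n : ℕ) :
    (∑ i, Env.tmul K s (e K s i) (e K s (i + ((n + 1 : ℕ) : ZMod s)))) * diffY K s n =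
      diffY K s n * ∑ i, Env.tmul K s (e K s i) (e K s (i + (n : ZMod s))) :=
  sum_tmul_mul_diff K s n _ (e_mul_y K s)

theorem inclQ_d (n : ℕ) (z : Q K s (n + 1)) :
    inclQ K s n (d K s n z) = dFree K s n (inclQ K s (n + 1) z) := by
  obtain ⟨f, rfl⟩ := projQ_surjective K s (n + 1) z
  rw [d_projQ]
  ext j
  rw [inclQ_projQ, dFree_apply, dFree_apply, inclQ_projQ, inclQ_projQ, mul_assoc (f j.succ),
    mul_assoc (f j.castSucc), sum_tmul_mul_diffX, sum_tmul_mul_diffY, add_mul, mul_assoc, mul_assoc]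

/-! ### Exactness -/

theorem exact_d_d (n : ℕ) : Function.Exact (d K s (n + 1)) (d K s n) := by
  intro z
  constructor
  · intro hz
    obtain ⟨g, hg⟩ := exists_dFree_eq K s n (inclQ K s (n + 1) z) (by
      rw [← inclQ_d, hz, map_zero])
    exact ⟨projQ K s (n + 2) g, by rw [d_projQ, hg, projQ_inclQ_apply]⟩
  · rintro ⟨w, rfl⟩
    obtain ⟨f, rfl⟩ := projQ_surjective K s (n + 2) w
    rw [d_projQ, d_projQ, dFree_dFree, map_zero]

theorem d0_projQ (f : Fin 1 → Env K s) : d0 K s (projQ K s 0 f) = f 0 • (1 : Lam K s) := by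
  have h : d0 K s (bSum K s 0 0) = 1 := by
    rw [bSum, map_sum, ← sum_e]
    refine Finset.sum_congr rfl fun i _ => ?_
    rw [d0, b, DirectSum.toModule_lof, homOf_gen, Env.tmul_smul, mul_one, Nat.cast_zero, add_zero,
      e_mul_e]
  rw [projQ_apply, Fin.sum_univ_one, map_smul, h]

theorem d0_surjective : Function.Surjective (d0 K s) := fun a =>
  ⟨projQ K s 0 fun _ => Env.tmul K s a 1, by rw [d0_projQ, Env.tmul_smul, mul_one, mul_one]⟩

/-- Modulo the image of `d 0`, a factor can be moved across the tensor sign. -/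
theorem projQ_tmul_sub_mem_range (a u w : Lam K s) :
    Env.tmul K s u (a * w) • bSum K s 0 0 - Env.tmul K s (u * a) w • bSum K s 0 0 ∈
      LinearMap.range (d K s 0) := by
  have hd : ∀ f : Fin 2 → Env K s, (f 1 * diffX K s 0 + f 0 * diffY K s 0) • bSum K s 0 0 ∈
      LinearMap.range (d K s 0) := fun f =>
    ⟨projQ K s 1 f, by rw [d_projQ, projQ_apply, Fin.sum_univ_one, dFree_apply]; rfl⟩
  induction a using Lam.induction generalizing u w with
  | he k =>
    -- An idempotent crosses the tensor sign already in `Q⁰`: both sides vanish on `b^0_{i,0}`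
    -- unless `i = k`.
    have h : ∀ i, Env.tmul K s u (e K s k * w) • b K s 0 i 0 =
        Env.tmul K s (u * e K s k) w • b K s 0 i 0 := fun i => by
      have h0 : i + ((0 : ℕ) : ZMod s) = i := by rw [Nat.cast_zero, add_zero]
      have hi : Env.tmul K s (e K s i) (e K s i) • b K s 0 i 0 = b K s 0 i 0 :=
        (congrArg (fun k => Env.tmul K s (e K s i) (e K s k) • b K s 0 i 0) h0).symm.trans
          (smul_b K s 0 i 0)
      rw [← hi, smul_smul, smul_smul, tmul_mul_tmul, tmul_mul_tmul, ← mul_assoc, mul_assoc u]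
      by_cases hik : i = k
      · rw [hik, e_mul_e]
      · rw [e_mul_e_of_ne K s hik, e_mul_e_of_ne K s (Ne.symm hik), zero_mul, mul_zero, tmul_zero,
          zero_tmul]
    rw [bSum, Finset.smul_sum, Finset.smul_sum, Finset.sum_congr rfl fun i _ => h i, sub_self]
    exact zero_mem _
  | hx =>
    -- In degree 0 the sign is `-1`, so `(u ⊗ w) * diffX = u ⊗ xw - ux ⊗ w`.
    convert hd ![0, Env.tmul K s u w] using 1
    rw [← sub_smul]
    simp [diffX, rx, lx, mul_add, tmul_mul_tmul, sub_eq_add_neg]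
  | hy =>
    convert hd ![Env.tmul K s u w, 0] using 1
    rw [← sub_smul]
    simp [diffY, ry, ly, mul_add, tmul_mul_tmul, sub_eq_add_neg]
  | h0 => simp [tmul_zero, zero_tmul]
  | hadd a a' ha ha' =>
    convert add_mem (ha u w) (ha' u w) using 1
    rw [add_mul, mul_add, tmul_add, add_tmul, add_smul, add_smul]
    abel
  | hsmul c a ha =>
    convert ha (c • u) w using 1
    rw [smul_mul_assoc, ← smul_tmul, mul_smul_comm, smul_mul_assoc]
  | hmul a a' ha ha' =>
    convert add_mem (ha u (a' * w)) (ha' (u * a) w) using 1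
    rw [mul_assoc, mul_assoc, sub_add_sub_cancel]

theorem exact_d_d0 : Function.Exact (d K s 0) (d0 K s) := by
  -- Moving the whole right factor to the left replaces `c` by `(c • 1) ⊗ 1`, where `c • 1` is the
  -- value of `d0`; so a cycle is a boundary.
  have key : ∀ c : Env K s, c • bSum K s 0 0 - Env.tmul K s (c • (1 : Lam K s)) 1 • bSum K s 0 0 ∈
      LinearMap.range (d K s 0) := fun c => by
    induction c using Env.induction with
    | h0 => simp [zero_tmul]
    | hadd c c' hc hc' =>
      convert add_mem hc hc' using 1
      simp only [add_smul, add_tmul]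
      abel
    | htmul u w =>
      have h := projQ_tmul_sub_mem_range K s w u 1
      rwa [mul_one, ← mul_one u, ← Env.tmul_smul, mul_one] at h
  intro z
  constructor
  · intro hz
    obtain ⟨f, rfl⟩ := projQ_surjective K s 0 z
    rw [d0_projQ] at hz
    have h := key (f 0)
    rw [hz, zero_tmul, zero_smul, sub_zero] at h
    rwa [projQ_apply, Fin.sum_univ_one]
  · rintro ⟨w, rfl⟩
    obtain ⟨f, rfl⟩ := projQ_surjective K s 1 w
    rw [d_projQ, d0_projQ, dFree_apply, add_smul, mul_smul, mul_smul]
    simp [diffX, diffY, rx, ry, lx, ly, add_smul, Env.tmul_smul]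

/-! ### Minimality -/

theorem range_d_le_jacobson (n : ℕ) :
    LinearMap.range (d K s n) ≤ Module.jacobson (Env K s) (Q K s n) := by
  rintro _ ⟨w, rfl⟩
  obtain ⟨f, rfl⟩ := projQ_surjective K s (n + 1) w
  rw [d_projQ, projQ_apply]
  exact sum_mem fun j _ => Ring.jacobson_smul_top_le _ _
    (Submodule.smul_mem_smul (dFree_mem_jacobson K s n f j) Submodule.mem_top)

theorem isSuperfluous_of_le_range_d (n : ℕ) {L : Submodule (Env K s) (Q K s n)}
    (h : L ≤ LinearMap.range (d K s n)) : IsSuperfluous L :=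
  isSuperfluous_of_le_jacobson (h.trans (range_d_le_jacobson K s n))

end Lam

end

theorem theorem2p6 (K : Type*) [Field K] [IsAlgClosed K] (s : ℕ) [NeZero s] :
    IsMinimalProjectiveResolution (R := Lam.Env K s) (M := Lam K s) (P := Lam.Q K s)
      (Lam.d0 K s) (Lam.d K s) where
  exact_zero := Lam.exact_d_d0 K s
  exact_succ := Lam.exact_d_d K s
  cover_zero :=
    { projective := inferInstance
      surjective := Lam.d0_surjective K s
      superfluous := Lam.isSuperfluous_of_le_range_d K s 0
        (LinearMap.exact_iff.1 (Lam.exact_d_d0 K s)).le }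
  cover_succ n :=
    { projective := inferInstance
      surjective := LinearMap.surjective_rangeRestrict _
      superfluous := Lam.isSuperfluous_of_le_range_d K s (n + 1) (by
        rw [LinearMap.ker_rangeRestrict]
        exact (LinearMap.exact_iff.1 (Lam.exact_d_d K s n)).le) }
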